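/- A rooted tree with $n$ nodes is a tree on the label set $\{1,\dots,n\}$ together with a distinguished node, its root. A node of a rooted tree is a record if its label is the largest among the labels on the unique path from that node to the root (endpoints included). Let $R_\bullet(n,k)$ be the number of rooted trees with $n$ nodes and exactly $k$ records (so $R_\bullet(0,k)=0$ for all $k$). In the ring $\mathbb{R}[t][[z]]$ of formal power series in $z$ over the polynomial ring $\mathbb{R}[t]$, put $$\mathcal{R}_\bullet(z,t)=\sum_{n,k\ge 0}R_\bullet(n,k)\,\frac{z^n}{n!}\,t^k,\qquad \mathcal{T}(z)=\sum_{n\ge 1}n^{n-1}\,\frac{z^n}{n!}.$$ Then $$\mathcal{R}_\bullet(z,t)=\int_0^z\frac{1}{s}\,\frac{t\,\mathcal{T}(s)}{1-t\,\mathcal{T}(s)}\,ds ,$$ where the integral is the formal one, $\int_0^z s^{m}\,ds=\frac{z^{m+1}}{m+1}$ for $m\ge 0$, taken term by term; the series $1-t\,\mathcal{T}(s)$ is invertible and $t\,\mathcal{T}(s)/(1-t\,\mathcal{T}(s))$ has no constant term, so that it is divisible by $s$. -/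

import Mathlib

namespace CayleyRecords

/-- A rooted (Cayley) tree with `n` nodes: a tree on the `n` labels `0 < 1 < ⋯ < n - 1`
(order-isomorphic to `1 < 2 < ⋯ < n`), together with an arbitrary node, its root. -/
structure RootedTree (n : ℕ) where
  graph : SimpleGraph (Fin n)
  isTree : graph.IsTree
  root : Fin n

/-- A node `v` is a record if its label is the largest one along the path from `v` to the root.
(In a tree there is exactly one such path.) -/
def RootedTree.IsRecord {n : ℕ} (T : RootedTree n) (v : Fin n) : Prop :=
  ∃ p : T.graph.Walk v T.root, p.IsPath ∧ ∀ u ∈ p.support, u ≤ v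

/-- The number of records of a rooted tree. -/
noncomputable def RootedTree.numRecords {n : ℕ} (T : RootedTree n) : ℕ :=
  {v : Fin n | T.IsRecord v}.ncard

/-- The tree record number: the number of rooted trees with `n` nodes and `k` records. -/
noncomputable def treeRecordNumber (n k : ℕ) : ℕ :=
  Nat.card {T : RootedTree n // T.numRecords = k}

instance (n : ℕ) : Finite (RootedTree n) :=
  Finite.of_injective (fun T : RootedTree n => (T.graph, T.root)) (by
    rintro ⟨G, hG, r⟩ ⟨G', hG', r'⟩ h
    simp only [Prod.mk.injEq] at h
    obtain ⟨rfl, rfl⟩ := h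
    rfl)

/-- There are no rooted trees with more records than nodes, so that the sum over `k` in
`treeRecordGF` omits only zero terms. -/
theorem treeRecordNumber_eq_zero {n k : ℕ} (h : n < k) : treeRecordNumber n k = 0 := by
  have : IsEmpty {T : RootedTree n // T.numRecords = k} := by
    refine ⟨fun T => ?_⟩
    have h1 : T.1.numRecords ≤ n := by
      have := Set.ncard_le_card {v : Fin n | T.1.IsRecord v}
      simpa [RootedTree.numRecords] using this
    have := T.2
    omega
  simp [treeRecordNumber]

/-- The variable `t`, as an element of `A⟦z⟧`, where `A = ℝ[t]`. -/
noncomputable def t : PowerSeries (Polynomial ℝ) := PowerSeries.C Polynomial.X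

/-- The tree record function `∑_{n, k ≥ 0} R_•(n, k) (z ^ n / n!) t ^ k`, as an element of
`A⟦z⟧`, where `A = ℝ[t]`. -/
noncomputable def treeRecordGF : PowerSeries (Polynomial ℝ) :=
  PowerSeries.mk fun n =>
    ∑ k ∈ Finset.range (n + 1),
      Polynomial.monomial k ((treeRecordNumber n k : ℝ) / (n.factorial : ℝ))

/-- The coefficient of `z ^ n t ^ k` of the tree record function, for all `n` and `k`. -/
theorem coeff_treeRecordGF (n k : ℕ) :
    (PowerSeries.coeff n treeRecordGF).coeff k =
      (treeRecordNumber n k : ℝ) / (n.factorial : ℝ) := by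
  simp only [treeRecordGF, PowerSeries.coeff_mk, Polynomial.finsetSum_coeff,
    Polynomial.coeff_monomial, Finset.sum_ite_eq', Finset.mem_range]
  split_ifs with h
  · rfl
  · rw [treeRecordNumber_eq_zero (by omega)]
    simp

/-- The Cayley tree function `∑_{n ≥ 1} n ^ (n - 1) z ^ n / n!`, as an element of `A⟦z⟧`,
where `A = ℝ[t]`. -/
noncomputable def cayleyTree : PowerSeries (Polynomial ℝ) :=
  PowerSeries.mk fun n =>
    if n = 0 then 0 else Polynomial.C ((n : ℝ) ^ (n - 1) / (n.factorial : ℝ))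

/-- The formal quotient `f(z) / z` of a power series `f` with zero constant coefficient. -/
noncomputable def divZ {A : Type*} [CommRing A] (f : PowerSeries A) : PowerSeries A :=
  PowerSeries.mk fun n => PowerSeries.coeff (n + 1) f

theorem X_mul_divZ {A : Type*} [CommRing A] {f : PowerSeries A}
    (hf : PowerSeries.constantCoeff f = 0) : PowerSeries.X * divZ f = f := by
  simpa [divZ, hf] using (PowerSeries.sub_const_eq_X_mul_shift f).symm

/-- The formal integral `∫₀^z f(s) ds`, which sends `z ^ n` to `z ^ (n + 1) / (n + 1)`. -/
noncomputable def integral {A : Type*} [CommRing A] [Algebra ℚ A] (f : PowerSeries A) :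
    PowerSeries A :=
  PowerSeries.mk fun n =>
    if n = 0 then 0 else (1 / (n : ℚ)) • PowerSeries.coeff (n - 1) f

theorem constantCoeff_integral {A : Type*} [CommRing A] [Algebra ℚ A] (f : PowerSeries A) :
    PowerSeries.constantCoeff (integral f) = 0 := by
  rw [← PowerSeries.coeff_zero_eq_constantCoeff_apply]
  simp [integral]

theorem derivative_integral {A : Type*} [CommRing A] [Algebra ℚ A] (f : PowerSeries A) :
    PowerSeries.derivative A (integral f) = f := by
  ext n
  rw [PowerSeries.coeff_derivative]
  have h : ((n : A) + 1) = algebraMap ℚ A ((n : ℚ) + 1) := by simp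
  have h' : ((n : ℚ) + 1) ≠ 0 := by positivity
  simp only [integral, PowerSeries.coeff_mk, h]
  rw [mul_comm, ← Algebra.smul_def, if_neg (by omega), smul_smul]
  simp [h']

theorem constantCoeff_t_mul_cayleyTree : PowerSeries.constantCoeff (t * cayleyTree) = 0 := by
  have : PowerSeries.constantCoeff cayleyTree = 0 := by
    rw [← PowerSeries.coeff_zero_eq_constantCoeff_apply]
    simp [cayleyTree]
  simp [this]

/-- The series `1 - t T(z)` has constant coefficient `1`, so `invOfUnit _ 1` is its inverse. -/
theorem one_sub_mul_invOfUnit :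
    (1 - t * cayleyTree) * PowerSeries.invOfUnit (1 - t * cayleyTree) 1 = 1 := by
  apply PowerSeries.mul_invOfUnit
  simp only [map_sub, constantCoeff_t_mul_cayleyTree]
  simp

end CayleyRecords

namespace CayleyRecords

open Polynomial Function

/-- A rooted tree on `V`, given by the map that sends each node to its parent and fixes the root. -/
@[ext]
structure ParentTree (V : Type*) where
  parent : V → V
  root : V
  parent_root : parent root = root
  exists_iterate : ∀ v, ∃ k, parent^[k] v = root

namespace ParentTree

variable {V W : Type*}

instance [Finite V] : Finite (ParentTree V) :=
  Finite.of_injective (fun T : ParentTree V => (T.parent, T.root)) fun S T h => by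
    simp only [Prod.mk.injEq] at h
    exact ParentTree.ext h.1 h.2

theorem iterate_root (T : ParentTree V) (k : ℕ) : T.parent^[k] T.root = T.root :=
  iterate_fixed T.parent_root k

theorem eq_root_of_parent_eq (T : ParentTree V) {v : V} (h : T.parent v = v) : v = T.root := by
  obtain ⟨k, hk⟩ := T.exists_iterate v
  rwa [iterate_fixed h] at hk

/-- Induction from the root upwards along the edges of a tree. -/
theorem induction (T : ParentTree V) {p : V → Prop} (h0 : p T.root)
    (h1 : ∀ v, v ≠ T.root → p (T.parent v) → p v) (v : V) : p v := by
  obtain ⟨k, hk⟩ := T.exists_iterate v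
  induction k generalizing v with
  | zero => exact (show v = T.root from hk) ▸ h0
  | succ k ih =>
    by_cases hv : v = T.root
    · exact hv ▸ h0
    · exact h1 v hv (ih _ hk)

theorem eq_root_of_iterate_eq (T : ParentTree V) {v : V} {k : ℕ} (hk : k ≠ 0)
    (h : T.parent^[k] v = v) : v = T.root := by
  obtain ⟨m, hm⟩ := T.exists_iterate v
  have h1 : T.parent^[k * m] v = v := by
    rw [iterate_mul]
    exact iterate_fixed h m
  obtain ⟨j, hj⟩ : ∃ j, k * m = j + m :=
    ⟨k * m - m, (Nat.sub_add_cancel (Nat.le_mul_of_pos_left m (Nat.pos_of_ne_zero hk))).symm⟩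
  rw [hj, iterate_add_apply, hm, T.iterate_root] at h1
  exact h1.symm

/-- The underlying graph of a tree. -/
def graph (T : ParentTree V) : SimpleGraph V where
  Adj u v := u ≠ v ∧ (T.parent u = v ∨ T.parent v = u)
  symm := ⟨fun _ _ h => ⟨h.1.symm, h.2.symm⟩⟩
  loopless := ⟨fun _ h => h.1 rfl⟩

theorem graph_adj (T : ParentTree V) {u v : V} :
    T.graph.Adj u v ↔ u ≠ v ∧ (T.parent u = v ∨ T.parent v = u) := Iff.rfl

theorem graph_connected (T : ParentTree V) : T.graph.Connected := by
  have h : ∀ v, T.graph.Reachable v T.root :=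
    T.induction (SimpleGraph.Reachable.refl _) fun v hv ih =>
      (SimpleGraph.Adj.reachable (T.graph_adj.2
        ⟨fun h => hv (T.eq_root_of_parent_eq h.symm), Or.inl rfl⟩)).trans ih
  exact { preconnected := fun u v => (h u).trans (h v).symm, nonempty := ⟨T.root⟩ }

theorem graph_isTree [Finite V] (T : ParentTree V) : T.graph.IsTree := by
  classical
  have := Fintype.ofFinite V
  rw [SimpleGraph.isTree_iff_connected_and_card]
  refine ⟨T.graph_connected, le_antisymm ?_ T.graph_connected.card_vert_le_card_edgeSet_add_one⟩
  have h : T.graph.edgeSet ⊆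
      ((Finset.univ.erase T.root).image fun v => s(v, T.parent v) : Finset (Sym2 V)) := by
    intro e
    induction e with
    | _ u v =>
      rw [SimpleGraph.mem_edgeSet, graph_adj]
      rintro ⟨hne, h | h⟩
      · refine Finset.mem_coe.2 (Finset.mem_image.2 ⟨u, ?_, by rw [h]⟩)
        refine Finset.mem_erase.2 ⟨?_, Finset.mem_univ _⟩
        rintro rfl
        exact hne (T.parent_root.symm.trans h)
      · refine Finset.mem_coe.2 (Finset.mem_image.2 ⟨v, ?_, by rw [h, Sym2.eq_swap]⟩)
        refine Finset.mem_erase.2 ⟨?_, Finset.mem_univ _⟩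
        rintro rfl
        exact hne (T.parent_root.symm.trans h).symm
  have h1 := Set.ncard_le_ncard h (Finset.finite_toSet _)
  rw [Set.ncard_coe_finset] at h1
  have h2 := h1.trans Finset.card_image_le
  rw [Finset.card_erase_of_mem (Finset.mem_univ _), Finset.card_univ] at h2
  have h3 : 0 < Fintype.card V := Fintype.card_pos_iff.2 ⟨T.root⟩
  rw [Nat.card_eq_fintype_card (α := V), Nat.card_coe_set_eq]
  omega

/-- A node is a record if no node on its way to the root is larger. -/
def IsRecord [LE V] (T : ParentTree V) (v : V) : Prop :=
  ∀ k, T.parent^[k] v ≤ v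

/-- The number of records of a tree. -/
noncomputable def numRecords [LE V] (T : ParentTree V) : ℕ :=
  {v | T.IsRecord v}.ncard

end ParentTree

namespace RootedTree

variable {n : ℕ} (T : RootedTree n)

/-- The path from a node to the root. -/
noncomputable def pathToRoot (v : Fin n) : T.graph.Walk v T.root :=
  (T.isTree.existsUnique_path v T.root).choose

theorem isPath_pathToRoot (v : Fin n) : (T.pathToRoot v).IsPath :=
  (T.isTree.existsUnique_path v T.root).choose_spec.1

theorem eq_pathToRoot {v : Fin n} {p : T.graph.Walk v T.root} (hp : p.IsPath) :
    p = T.pathToRoot v :=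
  (T.isTree.existsUnique_path v T.root).unique hp (T.isPath_pathToRoot v)

/-- The parent of a node: the next node on the path to the root. -/
noncomputable def parent (v : Fin n) : Fin n := (T.pathToRoot v).snd

theorem iterate_parent (k : ℕ) (v : Fin n) : T.parent^[k] v = (T.pathToRoot v).getVert k := by
  induction k generalizing v with
  | zero => simp
  | succ k ih =>
    rw [iterate_succ_apply, ih]
    have h : (T.pathToRoot v).tail = T.pathToRoot (T.parent v) :=
      T.eq_pathToRoot (T.isPath_pathToRoot v).tail
    rw [← h]
    exact SimpleGraph.Walk.getVert_tail _

theorem parent_root : T.parent T.root = T.root := by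
  have h : SimpleGraph.Walk.nil = T.pathToRoot T.root :=
    T.eq_pathToRoot SimpleGraph.Walk.IsPath.nil
  rw [parent, ← h]
  rfl

/-- The parent description of a rooted tree. -/
noncomputable def toParentTree : ParentTree (Fin n) where
  parent := T.parent
  root := T.root
  parent_root := T.parent_root
  exists_iterate v := ⟨(T.pathToRoot v).length, by simp [iterate_parent]⟩

theorem adj_iff {u v : Fin n} :
    T.graph.Adj u v ↔ u ≠ v ∧ (T.parent u = v ∨ T.parent v = u) := by
  constructor
  · refine fun h => ⟨h.ne, ?_⟩
    by_cases hu : u ∈ (T.pathToRoot v).support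
    · right
      exact (T.isTree.isAcyclic.eq_snd_of_adj_start (T.isPath_pathToRoot v) h.symm hu).symm
    · left
      have hp := (T.isPath_pathToRoot v).cons (h := h) hu
      rw [parent, ← T.eq_pathToRoot hp]
      simp
  · have key : ∀ u v, u ≠ v → T.parent u = v → T.graph.Adj u v := by
      rintro u _ hne rfl
      refine SimpleGraph.Walk.adj_snd fun hnil => hne ?_
      have := hnil.eq
      subst this
      exact T.parent_root.symm
    rintro ⟨hne, h | h⟩
    · exact key u v hne h
    · exact (key v u hne.symm h).symm

theorem isRecord_iff (v : Fin n) : T.IsRecord v ↔ T.toParentTree.IsRecord v := by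
  have h : T.IsRecord v ↔ ∀ u ∈ (T.pathToRoot v).support, u ≤ v :=
    ⟨fun ⟨p, hp, h⟩ => T.eq_pathToRoot hp ▸ h, fun h => ⟨_, T.isPath_pathToRoot v, h⟩⟩
  rw [h]
  constructor
  · intro h k
    exact (T.iterate_parent k v).trans_le (h _ (SimpleGraph.Walk.getVert_mem_support _ k))
  · intro h u hu
    obtain ⟨k, rfl, -⟩ := SimpleGraph.Walk.mem_support_iff_exists_getVert.1 hu
    exact (T.iterate_parent k v).symm.trans_le (h k)

theorem numRecords_toParentTree : T.toParentTree.numRecords = T.numRecords := by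
  simp only [numRecords, ParentTree.numRecords, isRecord_iff]

theorem toParentTree_injective : Injective (toParentTree (n := n)) := by
  intro S T h
  have hp : S.parent = T.parent := congrArg ParentTree.parent h
  have hr : S.root = T.root := congrArg ParentTree.root h
  have hg : S.graph = T.graph := by
    ext u v
    rw [S.adj_iff, T.adj_iff, hp]
  cases S
  cases T
  congr

theorem toParentTree_surjective : Surjective (toParentTree (n := n)) := by
  intro T
  refine ⟨⟨T.graph, T.graph_isTree, T.root⟩, ?_⟩
  set S : RootedTree n := ⟨T.graph, T.graph_isTree, T.root⟩
  refine ParentTree.ext (funext ?_) rfl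
  change ∀ v, S.parent v = T.parent v
  refine T.induction (S.parent_root.trans T.parent_root.symm) fun v hv ih => ?_
  have hne : v ≠ T.parent v := fun h => hv (T.eq_root_of_parent_eq h.symm)
  have hadj : S.graph.Adj v (T.parent v) := T.graph_adj.2 ⟨hne, Or.inl rfl⟩
  refine (S.adj_iff.1 hadj).2.resolve_right fun h => hv ?_
  exact T.eq_root_of_iterate_eq two_ne_zero (ih.symm.trans h)

/-- Rooted trees as parent maps. -/
noncomputable def equivParentTree (n : ℕ) : RootedTree n ≃ ParentTree (Fin n) :=
  Equiv.ofBijective toParentTree ⟨toParentTree_injective, toParentTree_surjective⟩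

end RootedTree

end CayleyRecords

namespace CayleyRecords

open Polynomial Function

namespace ParentTree

variable {V W : Type*}

/-- Relabelling of the nodes. -/
@[simps]
def relabel (e : V ≃ W) (T : ParentTree V) : ParentTree W where
  parent w := e (T.parent (e.symm w))
  root := e T.root
  parent_root := by simp [T.parent_root]
  exists_iterate w := by
    obtain ⟨k, hk⟩ := T.exists_iterate (e.symm w)
    have h : Semiconj e T.parent (fun w => e (T.parent (e.symm w))) := fun v => by simp
    refine ⟨k, ?_⟩
    rw [← hk, h.iterate_right k, e.apply_symm_apply]

theorem iterate_relabel_parent (e : V ≃ W) (T : ParentTree V) (k : ℕ) (v : V) :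
    (T.relabel e).parent^[k] (e v) = e (T.parent^[k] v) := by
  have h : Semiconj e T.parent (T.relabel e).parent := fun v => by simp
  exact (h.iterate_right k v).symm

/-- Relabelling as a bijection. -/
@[simps]
def relabelEquiv (e : V ≃ W) : ParentTree V ≃ ParentTree W where
  toFun := relabel e
  invFun := relabel e.symm
  left_inv T := by ext <;> simp
  right_inv T := by ext <;> simp

theorem numRecords_relabel [LE V] [LE W] (e : V ≃o W) (T : ParentTree V) :
    (T.relabel e.toEquiv).numRecords = T.numRecords := by
  have h : {w | (T.relabel e.toEquiv).IsRecord w} = e '' {v | T.IsRecord v} := by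
    ext w
    obtain ⟨v, rfl⟩ := e.surjective w
    rw [e.injective.mem_set_image]
    refine forall_congr' fun k => ?_
    rw [← e.le_iff_le]
    exact iff_of_eq (congrArg (· ≤ e v) (T.iterate_relabel_parent e.toEquiv k v))
  rw [numRecords, h, Set.ncard_image_of_injective _ e.injective, numRecords]

section Graft

variable [DecidableEq V] {A : Finset V} (S : ParentTree A) (y : A) (T : ParentTree {v // v ∉ A})

/-- The parent map of `graft`. -/
def graftParent (v : V) : V :=
  if h : v ∈ A then S.parent ⟨v, h⟩
  else if (⟨v, h⟩ : {v // v ∉ A}) = T.root then y else T.parent ⟨v, h⟩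

theorem graftParent_mem (v : A) : graftParent S y T v = S.parent v := by
  simp [graftParent]

theorem iterate_graftParent_mem (k : ℕ) (v : A) :
    (graftParent S y T)^[k] v = S.parent^[k] v := by
  have h : Semiconj Subtype.val S.parent (graftParent S y T) :=
    fun v => (graftParent_mem S y T v).symm
  exact (h.iterate_right k v).symm

theorem graftParent_root : graftParent S y T T.root = y := by
  simp [graftParent, T.root.2]

theorem graftParent_of_ne {v : {v // v ∉ A}} (h : v ≠ T.root) :
    graftParent S y T v = T.parent v := by
  simp [graftParent, v.2, h]

theorem exists_iterate_graftParent (v : {v // v ∉ A}) :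
    ∃ k, (graftParent S y T)^[k] v = T.root := by
  induction v using T.induction with
  | h0 => exact ⟨0, rfl⟩
  | h1 v hv ih =>
    obtain ⟨k, hk⟩ := ih
    exact ⟨k + 1, by rwa [iterate_succ_apply, graftParent_of_ne S y T hv]⟩

/-- The tree obtained by attaching the root of `T` to the node `y` of `S`. -/
def graft : ParentTree V where
  parent := graftParent S y T
  root := S.root
  parent_root := by rw [graftParent_mem, S.parent_root]
  exists_iterate v := by
    have h : ∀ v : A, ∃ k, (graftParent S y T)^[k] v = S.root := fun v => by
      obtain ⟨k, hk⟩ := S.exists_iterate v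
      exact ⟨k, by rw [iterate_graftParent_mem, hk]⟩
    by_cases hv : v ∈ A
    · exact h ⟨v, hv⟩
    · obtain ⟨k, hk⟩ := exists_iterate_graftParent S y T ⟨v, hv⟩
      obtain ⟨m, hm⟩ := h y
      refine ⟨m + 1 + k, ?_⟩
      rw [iterate_add_apply, hk, iterate_succ_apply, graftParent_root, hm]

theorem mem_iff_iterate_graft_ne (v : V) :
    v ∈ A ↔ ∀ k, (graft S y T).parent^[k] v ≠ T.root := by
  constructor
  · intro h k hk
    have h1 := iterate_graftParent_mem S y T k ⟨v, h⟩
    exact T.root.2 (hk ▸ h1 ▸ (S.parent^[k] ⟨v, h⟩).2)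
  · intro h
    by_contra hv
    obtain ⟨k, hk⟩ := exists_iterate_graftParent S y T ⟨v, hv⟩
    exact h k hk

variable {S y T} in
theorem graft_injective {S' : ParentTree A} {y' : A} {T' : ParentTree {v // v ∉ A}}
    (hr : T.root = T'.root) (h : graft S y T = graft S' y' T') :
    S = S' ∧ y = y' ∧ T = T' := by
  have hp : graftParent S y T = graftParent S' y' T' := congrArg parent h
  refine ⟨ParentTree.ext (funext fun v => Subtype.ext ?_) (Subtype.ext (congrArg root h)),
    Subtype.ext ?_, ParentTree.ext (funext fun v => ?_) hr⟩
  · rw [← graftParent_mem S y T, hp, graftParent_mem]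
  · rw [← graftParent_root S y T, hp, hr, graftParent_root]
  · by_cases hv : v = T.root
    · rw [hv, T.parent_root, hr, T'.parent_root]
    · apply Subtype.ext
      rw [← graftParent_of_ne S y T hv, hp, graftParent_of_ne S' y' T' (hr ▸ hv)]

/-- Every tree is obtained by grafting the subtree at any given node other than the root. -/
theorem exists_graft_eq [Fintype V] (P : ParentTree V) {x : V} (hx : P.root ≠ x) :
    ∃ (A : Finset V) (S : ParentTree A) (y : A) (T : ParentTree {v // v ∉ A}),
      T.root = x ∧ graft S y T = P := by
  classical
  set A : Finset V := Finset.univ.filter fun v => ∀ k, P.parent^[k] v ≠ x with hA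
  have memA : ∀ {v}, v ∈ A ↔ ∀ k, P.parent^[k] v ≠ x := by simp [hA]
  have parent_mem : ∀ {v}, v ∈ A → P.parent v ∈ A := fun h =>
    memA.2 fun k => memA.1 h (k + 1)
  have x_notMem : x ∉ A := fun h => memA.1 h 0 rfl
  have parent_notMem : ∀ {v}, v ∉ A → v ≠ x → P.parent v ∉ A := by
    intro v hv hvx h
    refine hv (memA.2 fun k => ?_)
    cases k with
    | zero => exact hvx
    | succ k => exact memA.1 h k
  have root_mem : P.root ∈ A := memA.2 fun k => by rwa [P.iterate_root]
  have x_parent_mem : P.parent x ∈ A := memA.2 fun k hk =>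
    hx (P.eq_root_of_iterate_eq (k := k + 1) k.succ_ne_zero hk).symm
  let S : ParentTree A :=
    { parent := fun v => ⟨P.parent v, parent_mem v.2⟩
      root := ⟨P.root, root_mem⟩
      parent_root := Subtype.ext P.parent_root
      exists_iterate := fun v => by
        obtain ⟨k, hk⟩ := P.exists_iterate v
        refine ⟨k, Subtype.ext ?_⟩
        have h : Semiconj (Subtype.val : A → V) (fun v => ⟨P.parent v, parent_mem v.2⟩) P.parent :=
          fun v => rfl
        exact (h.iterate_right k v).trans hk }
  let f : {v // v ∉ A} → {v // v ∉ A} := fun v =>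
    if h : (v : V) = x then ⟨x, x_notMem⟩ else ⟨P.parent v, parent_notMem v.2 h⟩
  have f_root : f ⟨x, x_notMem⟩ = ⟨x, x_notMem⟩ := by simp [f]
  let T : ParentTree {v // v ∉ A} :=
    { parent := f
      root := ⟨x, x_notMem⟩
      parent_root := f_root
      exists_iterate := fun v => by
        obtain ⟨v, hv⟩ := v
        obtain ⟨k, hk⟩ : ∃ k, P.parent^[k] v = x := by
          by_contra! h
          exact hv (memA.2 h)
        refine ⟨k, ?_⟩
        induction k generalizing v with
        | zero => exact Subtype.ext hk
        | succ k ih =>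
          by_cases hvx : v = x
          · subst hvx
            exact iterate_fixed f_root _
          · have hf : f ⟨v, hv⟩ = ⟨P.parent v, parent_notMem hv hvx⟩ := by simp [f, hvx]
            rw [iterate_succ_apply, hf]
            exact ih _ _ hk }
  refine ⟨A, S, ⟨P.parent x, x_parent_mem⟩, T, rfl, ParentTree.ext (funext fun v => ?_) rfl⟩
  change graftParent _ _ _ v = _
  by_cases hv : v ∈ A
  · exact graftParent_mem S _ T ⟨v, hv⟩
  · by_cases hvx : v = x
    · subst hvx
      exact graftParent_root S _ T
    · rw [graftParent_of_ne S _ T (v := ⟨v, hv⟩) fun h => hvx (congrArg Subtype.val h)]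
      simp [T, f, hvx]

theorem numRecords_graft [Finite V] [PartialOrder V] (h : ∀ v : V, v ≤ T.root) :
    (graft S y T).numRecords = S.numRecords + 1 := by
  have hx : ((T.root : V)) ∉ (Subtype.val : A → V) '' {v | S.IsRecord v} := by
    rintro ⟨v, -, hv⟩
    exact T.root.2 (hv ▸ v.2)
  have hset : {v | (graft S y T).IsRecord v} =
      insert (T.root : V) ((Subtype.val : A → V) '' {v | S.IsRecord v}) := by
    ext v
    by_cases hv : v ∈ A
    · lift v to A using hv
      have hne : (v : V) ≠ T.root := fun hv => T.root.2 (hv ▸ v.2)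
      rw [Set.mem_insert_iff, or_iff_right hne, Subtype.val_injective.mem_set_image]
      refine forall_congr' fun k => ?_
      rw [← Subtype.coe_le_coe, ← iterate_graftParent_mem S y T k v]
      rfl
    · have hne : v ∉ (Subtype.val : A → V) '' {v | S.IsRecord v} := by
        rintro ⟨w, -, rfl⟩
        exact hv w.2
      rw [Set.mem_insert_iff, or_iff_left hne]
      constructor
      · intro hrec
        obtain ⟨k, hk⟩ := exists_iterate_graftParent S y T ⟨v, hv⟩
        exact le_antisymm (h v) (hk.symm.trans_le (hrec k))
      · rintro rfl k
        exact h _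
  rw [numRecords, hset, Set.ncard_insert_of_notMem hx,
    Set.ncard_image_of_injective _ Subtype.val_injective, numRecords]

end Graft

theorem numRecords_of_root_max [PartialOrder V] (T : ParentTree V) (h : ∀ v, v ≤ T.root) :
    T.numRecords = 1 := by
  have hset : {v | T.IsRecord v} = {T.root} := by
    ext v
    constructor
    · intro hrec
      obtain ⟨k, hk⟩ := T.exists_iterate v
      exact le_antisymm (h v) (hk.symm.trans_le (hrec k))
    · rintro rfl k
      exact h _
  rw [numRecords, hset, Set.ncard_singleton]

end ParentTree

end CayleyRecords

namespace CayleyRecords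

open Polynomial Function

namespace ParentTree

noncomputable instance (V : Type*) [Finite V] : Fintype (ParentTree V) := Fintype.ofFinite _

/-- The generating polynomial of the trees on `V` by number of records. -/
noncomputable def recordPoly (V : Type*) [Finite V] [LE V] : ℝ[X] :=
  ∑ T : ParentTree V, X ^ T.numRecords

/-- The number of trees on `n + 1` nodes with a given root. -/
noncomputable def fixedRootNumber (n : ℕ) : ℕ :=
  Nat.card {T : ParentTree (Fin (n + 1)) // T.root = Fin.last n}

theorem recordPoly_congr {V W : Type*} [Finite V] [Finite W] [LE V] [LE W] (e : V ≃o W) :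
    recordPoly V = recordPoly W :=
  Fintype.sum_equiv (relabelEquiv e.toEquiv) _ _ fun T => by
    rw [relabelEquiv_apply, numRecords_relabel]

theorem recordPoly_finset {V : Type*} [Finite V] [LinearOrder V] (A : Finset V) :
    recordPoly A = recordPoly (Fin A.card) :=
  (recordPoly_congr (A.orderIsoOfFin rfl)).symm

theorem card_root_eq {V : Type*} [Finite V] {n : ℕ} (hV : Nat.card V = n + 1) (x : V) :
    Nat.card {T : ParentTree V // T.root = x} = fixedRootNumber n := by
  classical
  let e₀ : V ≃ Fin (n + 1) := Finite.equivFinOfCardEq hV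
  let e : V ≃ Fin (n + 1) := e₀.trans (Equiv.swap (e₀ x) (Fin.last n))
  have he : e x = Fin.last n := by simp [e]
  refine Nat.card_congr ((relabelEquiv e).subtypeEquiv fun T => ?_)
  rw [relabelEquiv_apply, relabel_root, ← he, e.apply_eq_iff_eq]

theorem card_parentTree (n : ℕ) :
    Nat.card (ParentTree (Fin (n + 1))) = (n + 1) * fixedRootNumber n := by
  rw [Nat.card_congr (Equiv.sigmaFiberEquiv (root : ParentTree (Fin (n + 1)) → _)).symm,
    Nat.card_sigma]
  rw [Finset.sum_congr rfl fun x _ => card_root_eq (Nat.card_fin (n + 1)) x]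
  simp

/-- The data from which `graft` produces the trees whose root is not `x`. -/
abbrev GraftData {V : Type*} (x : V) : Type _ :=
  Σ A : {A : Finset V // x ∉ A},
    ParentTree A.1 × A.1 × {T : ParentTree {v // v ∉ A.1} // T.root = ⟨x, A.2⟩}

/-- Trees whose root is not `x`, cut at the edge from `x` towards the root. -/
noncomputable def graftEquiv {V : Type*} [Fintype V] [DecidableEq V] (x : V) :
    GraftData x ≃ {T : ParentTree V // ¬ T.root = x} :=
  Equiv.ofBijective
    (fun D => ⟨graft D.2.1 D.2.2.1 D.2.2.2.1,
      ne_of_mem_of_not_mem (show (D.2.1.root : V) ∈ D.1.1 from D.2.1.root.2) D.1.2⟩) <| by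
    constructor
    · rintro ⟨⟨A, hA⟩, S, y, T, hT⟩ ⟨⟨A', hA'⟩, S', y', T', hT'⟩ h
      have h := congrArg Subtype.val h
      dsimp only at h
      obtain rfl : A = A' := by
        ext v
        rw [mem_iff_iterate_graft_ne S y T, mem_iff_iterate_graft_ne S' y' T', h, hT, hT']
      obtain ⟨rfl, rfl, rfl⟩ := graft_injective (hT.trans hT'.symm) h
      rfl
    · rintro ⟨P, hP⟩
      obtain ⟨A, S, y, T, rfl, rfl⟩ := exists_graft_eq P hP
      exact ⟨⟨⟨A, T.root.2⟩, S, y, T, rfl⟩, rfl⟩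

/-- The recursion that results from removing the edge from the largest node towards the root. -/
theorem recordPoly_succ (n : ℕ) :
    recordPoly (Fin (n + 1)) = (X : ℝ[X]) * (fixedRootNumber n +
      ∑ m ∈ Finset.range (n + 1),
        (n.choose m : ℝ[X]) * (m * recordPoly (Fin m) * fixedRootNumber (n - m))) := by
  classical
  set x := Fin.last n
  have hroot : ∑ T : {T : ParentTree (Fin (n + 1)) // T.root = x}, (X : ℝ[X]) ^ T.1.numRecords =
      (X : ℝ[X]) * fixedRootNumber n := by
    have h1 : ∀ T : {T : ParentTree (Fin (n + 1)) // T.root = x},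
        (X : ℝ[X]) ^ T.1.numRecords = X := fun T => by
      rw [T.1.numRecords_of_root_max fun v => T.2.symm ▸ Fin.le_last v, pow_one]
    rw [Finset.sum_congr rfl fun T _ => h1 T, Finset.sum_const, Finset.card_univ,
      ← Nat.card_eq_fintype_card, nsmul_eq_mul, mul_comm, fixedRootNumber]
  have hA : ∀ A : {A : Finset (Fin (n + 1)) // x ∉ A},
      ∑ D : ParentTree A.1 × A.1 × {T : ParentTree {v // v ∉ A.1} // T.root = ⟨x, A.2⟩},
        (X : ℝ[X]) ^ (graft D.1 D.2.1 D.2.2.1).numRecords =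
      (X : ℝ[X]) * (A.1.card * recordPoly (Fin A.1.card) * fixedRootNumber (n - A.1.card)) := by
    rintro ⟨A, hxA⟩
    have hcard : A.card ≤ n := by
      have := Finset.card_lt_univ_of_notMem hxA
      rw [Fintype.card_fin] at this
      omega
    have hV : Nat.card {v // v ∉ A} = (n - A.card) + 1 := by
      rw [Nat.card_eq_fintype_card, Fintype.card_subtype_compl, Fintype.card_fin,
        Fintype.card_coe]
      omega
    have hrec : ∀ D : ParentTree A × A × {T : ParentTree {v // v ∉ A} // T.root = ⟨x, hxA⟩},
        (X : ℝ[X]) ^ (graft D.1 D.2.1 D.2.2.1).numRecords = X ^ D.1.numRecords * X := by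
      rintro ⟨S, y, T, hT⟩
      rw [numRecords_graft S y T fun v => hT.symm ▸ Fin.le_last v, pow_succ]
    rw [Finset.sum_congr rfl fun D _ => hrec D, Fintype.sum_prod_type]
    simp only [Finset.sum_const, Finset.card_univ, nsmul_eq_mul, Fintype.card_prod]
    rw [← Finset.mul_sum, ← Finset.sum_mul, Fintype.card_coe, ← recordPoly_finset, recordPoly,
      ← Nat.card_eq_fintype_card, card_root_eq hV]
    push_cast
    ring
  have hsum : ∑ T : {T : ParentTree (Fin (n + 1)) // ¬ T.root = x},
      (X : ℝ[X]) ^ T.1.numRecords = (X : ℝ[X]) * ∑ m ∈ Finset.range (n + 1),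
        (n.choose m : ℝ[X]) * (m * recordPoly (Fin m) * fixedRootNumber (n - m)) := by
    rw [← Equiv.sum_comp (graftEquiv x), Fintype.sum_sigma]
    refine (Finset.sum_congr rfl fun A _ => hA A).trans ?_
    rw [← Finset.mul_sum]
    congr 1
    let f : ℕ → ℝ[X] := fun m => m * recordPoly (Fin m) * fixedRootNumber (n - m)
    have h1 : ∑ A ∈ (Finset.univ.erase x).powerset, f A.card =
        ∑ A : {A : Finset (Fin (n + 1)) // x ∉ A}, f A.1.card :=
      Finset.sum_subtype _ (fun A => by simp [Finset.subset_erase]) _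
    refine h1.symm.trans ?_
    rw [Finset.sum_powerset_apply_card, Finset.card_erase_of_mem (Finset.mem_univ _),
      Finset.card_univ, Fintype.card_fin, Nat.add_sub_cancel]
    simp only [nsmul_eq_mul, f]
  rw [mul_add, ← hroot, ← hsum]
  exact (Fintype.sum_subtype_add_sum_subtype (fun T : ParentTree (Fin (n + 1)) => T.root = x)
    fun T => (X : ℝ[X]) ^ T.numRecords).symm

end ParentTree

end CayleyRecords

namespace CayleyRecords

open Polynomial

/-- An instance of Abel's binomial identity, as an identity of polynomials. -/
theorem abel_binomial_identity (n : ℕ) :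
    ∑ k ∈ Finset.range (n + 1),
      C ((n.choose k : ℝ) * (k + 1 : ℝ) ^ (k - 1)) * (X - C (k : ℝ)) ^ (n - k) = (X + C 1) ^ n := by
  induction n with
  | zero => simp
  | succ n ih =>
    set P : ℝ[X] := ∑ k ∈ Finset.range (n + 1 + 1),
      C (((n + 1).choose k : ℝ) * (k + 1 : ℝ) ^ (k - 1)) * (X - C (k : ℝ)) ^ (n + 1 - k) with hP
    have hderiv : derivative (P - (X + C 1) ^ (n + 1)) = 0 := by
      have h1 : derivative P = C (n + 1 : ℝ) * (X + C 1) ^ n := by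
        rw [hP, Finset.sum_range_succ, map_add, derivative_sum, ← ih, Finset.mul_sum]
        rw [Nat.sub_self, pow_zero, mul_one, derivative_C, add_zero]
        refine Finset.sum_congr rfl fun k hk => ?_
        have hk : k ≤ n := Nat.lt_succ_iff.1 (Finset.mem_range.1 hk)
        rw [derivative_C_mul, derivative_X_sub_C_pow, Nat.sub_right_comm, Nat.add_sub_cancel,
          ← mul_assoc, ← mul_assoc, ← C_mul, ← C_mul]
        congr 2
        have h2 : ((n + 1).choose k : ℝ) * ((n + 1 - k : ℕ) : ℝ) = (n + 1) * n.choose k := by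
          rw [mul_comm (n + 1 : ℝ)]
          exact_mod_cast (Nat.choose_mul_succ_eq n k).symm
        linear_combination (k + 1 : ℝ) ^ (k - 1) * h2
      rw [map_sub, h1, derivative_X_add_C_pow, Nat.add_sub_cancel]
      simp
    have heval : (P - (X + C 1) ^ (n + 1)).eval (-1) = 0 := by
      have h1 := congrFun (fwdDiff_iter_pow_eq_zero_of_lt (R := ℝ) (Nat.lt_succ_self n)) 1
      rw [fwdDiff_iter_eq_sum_shift] at h1
      rw [eval_sub, eval_pow, hP, eval_finsetSum]
      simp only [eval_add, eval_X, eval_C, neg_add_cancel, ne_eq, Nat.add_eq_zero_iff,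
        one_ne_zero, and_false, not_false_eq_true, zero_pow, sub_zero]
      refine Eq.trans (Finset.sum_congr rfl fun k hk => ?_) h1
      have hk : k ≤ n + 1 := Nat.lt_succ_iff.1 (Finset.mem_range.1 hk)
      have h2 : (-1 - k : ℝ) ^ (n + 1 - k) = (-1) ^ (n + 1 - k) * (k + 1 : ℝ) ^ (n + 1 - k) := by
        rw [← mul_pow]
        congr 1
        ring
      have h3 : (k + 1 : ℝ) ^ (k - 1) * (k + 1 : ℝ) ^ (n + 1 - k) = (k + 1 : ℝ) ^ n := by
        rcases Nat.eq_zero_or_pos k with rfl | hk0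
        · simp
        · rw [← pow_add]
          congr 1
          omega
      simp only [eval_mul, eval_C, eval_pow, eval_sub, eval_X, h2, nsmul_eq_mul, mul_one,
        zsmul_eq_mul]
      push_cast
      rw [add_comm 1 (k : ℝ), ← h3]
      ring
    obtain ⟨c, hc⟩ := natDegree_eq_zero.1 (derivative_eq_zero.1 hderiv)
    rw [← hc, eval_C] at heval
    rw [heval, C_0] at hc
    exact sub_eq_zero.1 hc.symm

theorem abel_binomial_sum (n : ℕ) :
    ∑ m ∈ Finset.range (n + 1), (n.choose m : ℝ) * ((m : ℝ) ^ m * (n - m + 1 : ℕ) ^ (n - m - 1)) =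
      (n + 1 : ℝ) ^ n := by
  have h := congrArg (eval (n : ℝ)) (abel_binomial_identity n)
  rw [eval_finsetSum, ← Finset.sum_range_reflect] at h
  simp only [eval_mul, eval_C, eval_pow, eval_sub, eval_add, eval_X] at h
  rw [← h]
  refine Finset.sum_congr rfl fun m hm => ?_
  have hm : m ≤ n := Nat.lt_succ_iff.1 (Finset.mem_range.1 hm)
  rw [Nat.add_sub_cancel, Nat.choose_symm hm, Nat.sub_sub_self hm]
  push_cast [Nat.cast_sub hm]
  ring

namespace ParentTree

theorem eval_one_recordPoly_succ (n : ℕ) :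
    (recordPoly (Fin (n + 1))).eval 1 = (n + 1) * fixedRootNumber n := by
  have h := card_parentTree n
  rw [Nat.card_eq_fintype_card] at h
  simp only [recordPoly, eval_finsetSum, eval_pow, eval_X, one_pow, Finset.sum_const,
    Finset.card_univ, h, nsmul_eq_mul, mul_one]
  push_cast
  rfl

theorem fixedRootNumber_zero : fixedRootNumber 0 = 1 := by
  refine Nat.card_eq_one_iff_unique.2 ⟨⟨fun S T => ?_⟩, ⟨⟨⟨id, Fin.last 0, rfl, fun v => ?_⟩, rfl⟩⟩⟩
  · exact Subtype.ext (ParentTree.ext (Subsingleton.elim (α := Fin 1 → Fin 1) _ _)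
      (Subsingleton.elim (α := Fin 1) _ _))
  · exact ⟨0, Subsingleton.elim (α := Fin 1) _ _⟩

/-- Cayley's formula. -/
theorem fixedRootNumber_eq (n : ℕ) : fixedRootNumber n = (n + 1) ^ (n - 1) := by
  induction n using Nat.strong_induction_on with
  | _ n ih =>
    rcases Nat.eq_zero_or_pos n with rfl | hn
    · exact fixedRootNumber_zero
    have h := congrArg (eval 1) (recordPoly_succ n)
    rw [eval_one_recordPoly_succ, eval_mul, eval_X, one_mul, eval_add, eval_finsetSum,
      Finset.sum_range_succ'] at h
    have habel := abel_binomial_sum n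
    rw [Finset.sum_range_succ'] at habel
    have hsum : ∀ m ∈ Finset.range n,
        eval 1 ((n.choose (m + 1) : ℝ[X]) *
          (((m + 1 : ℕ) : ℝ[X]) * recordPoly (Fin (m + 1)) * (fixedRootNumber (n - (m + 1)) : ℝ[X]))) =
        (n.choose (m + 1) : ℝ) * (((m + 1 : ℕ) : ℝ) ^ (m + 1) *
          (n - (m + 1) + 1 : ℕ) ^ (n - (m + 1) - 1)) := by
      intro m hm
      have hm := Finset.mem_range.1 hm
      have hpow : (m + 1 : ℝ) * ((m + 1) * (m + 1) ^ (m - 1)) = (m + 1) ^ (m + 1) := by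
        rcases Nat.eq_zero_or_pos m with rfl | hm0
        · simp
        · obtain ⟨j, rfl⟩ := Nat.exists_eq_succ_of_ne_zero hm0.ne'
          rw [Nat.succ_eq_add_one, Nat.add_sub_cancel]
          ring
      rw [eval_mul, eval_mul, eval_mul, eval_one_recordPoly_succ, eval_natCast, eval_natCast,
        eval_natCast, ih m hm, ih _ (by omega)]
      push_cast
      rw [hpow]
    rw [Finset.sum_congr rfl hsum] at h
    obtain ⟨j, rfl⟩ := Nat.exists_eq_succ_of_ne_zero hn.ne'
    simp only [Nat.cast_zero, zero_mul, mul_zero, eval_zero, add_zero, eval_natCast] at h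
    simp only [Nat.choose_zero_right, pow_zero, Nat.sub_zero, Nat.succ_eq_add_one,
      Nat.add_sub_cancel, Nat.cast_one, one_mul, Nat.cast_zero] at habel
    have hj : (j + 1 : ℝ) ≠ 0 := by positivity
    have : (fixedRootNumber (j + 1) : ℝ) = (j + 1 + 1) ^ j := by
      apply mul_left_cancel₀ hj
      push_cast at h habel
      rw [pow_succ] at habel
      linear_combination h + habel
    rw [Nat.succ_eq_add_one, Nat.add_sub_cancel]
    exact_mod_cast this

end ParentTree

end CayleyRecords

namespace CayleyRecords

open Polynomial ParentTree

theorem treeRecordNumber_eq (n k : ℕ) :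
    treeRecordNumber n k = Nat.card {T : ParentTree (Fin n) // T.numRecords = k} :=
  Nat.card_congr ((RootedTree.equivParentTree n).subtypeEquiv fun T => by
    rw [← T.numRecords_toParentTree]
    rfl)

theorem coeff_recordPoly (n k : ℕ) :
    (recordPoly (Fin n)).coeff k = treeRecordNumber n k := by
  classical
  rw [treeRecordNumber_eq, Nat.card_eq_fintype_card, Fintype.card_subtype]
  simp only [recordPoly, finsetSum_coeff, coeff_X_pow, Finset.sum_boole, eq_comm]

theorem coeff_treeRecordGF_eq (n : ℕ) :
    PowerSeries.coeff n treeRecordGF = C (1 / (n.factorial : ℝ)) * recordPoly (Fin n) := by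
  ext k
  rw [coeff_treeRecordGF, coeff_C_mul, coeff_recordPoly]
  ring

theorem coeff_succ_cayleyTree (n : ℕ) :
    PowerSeries.coeff (n + 1) cayleyTree =
      C (1 / (n.factorial : ℝ)) * (fixedRootNumber n : ℝ[X]) := by
  rw [cayleyTree, PowerSeries.coeff_mk, if_neg n.succ_ne_zero, fixedRootNumber_eq,
    ← C_eq_natCast, ← C_mul]
  congr 1
  have h : ((n + 1 : ℕ) : ℝ) ≠ 0 := by positivity
  have hn : (n.factorial : ℝ) ≠ 0 := by positivity
  rw [Nat.factorial_succ, Nat.add_sub_cancel]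
  push_cast at h ⊢
  cases n with
  | zero => simp
  | succ n =>
    rw [Nat.add_sub_cancel, pow_succ]
    field_simp

/-- The series `z R'(z)`, where `R` is the tree record function. -/
noncomputable def pointedRecordGF : PowerSeries ℝ[X] :=
  PowerSeries.mk fun n => (n : ℝ[X]) * PowerSeries.coeff n treeRecordGF

theorem pointedRecordGF_eq :
    pointedRecordGF = t * cayleyTree + t * cayleyTree * pointedRecordGF := by
  ext1 n
  rw [map_add, mul_assoc, t, PowerSeries.coeff_C_mul, PowerSeries.coeff_C_mul]
  cases n with
  | zero => simp [pointedRecordGF, cayleyTree, PowerSeries.coeff_mul]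
  | succ n =>
    have hfac : ((n + 1 : ℕ) : ℝ[X]) * C (1 / ((n + 1).factorial : ℝ)) =
        C (1 / (n.factorial : ℝ)) := by
      rw [← C_eq_natCast, ← C_mul, Nat.factorial_succ]
      congr 1
      push_cast
      field_simp
    rw [mul_comm cayleyTree, PowerSeries.coeff_mul,
      Finset.Nat.sum_antidiagonal_eq_sum_range_succ_mk, Finset.sum_range_succ]
    have hlast : PowerSeries.coeff (n + 1 - (n + 1)) cayleyTree = 0 := by simp [cayleyTree]
    rw [hlast, mul_zero, add_zero, pointedRecordGF, PowerSeries.coeff_mk, coeff_treeRecordGF_eq,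
      ← mul_assoc, hfac, recordPoly_succ, coeff_succ_cayleyTree, ← mul_add, mul_left_comm]
    congr 1
    rw [mul_add, Finset.mul_sum]
    congr 1
    refine Finset.sum_congr rfl fun m hm => ?_
    have hm : m ≤ n := Nat.lt_succ_iff.1 (Finset.mem_range.1 hm)
    rw [PowerSeries.coeff_mk, Nat.succ_sub hm, coeff_succ_cayleyTree, coeff_treeRecordGF_eq]
    have hc : C (1 / (n.factorial : ℝ)) * (n.choose m : ℝ[X]) =
        C (1 / (m.factorial : ℝ)) * C (1 / ((n - m).factorial : ℝ)) := by
      rw [← C_eq_natCast, ← C_mul, ← C_mul, Nat.cast_choose ℝ hm]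
      congr 1
      field_simp
    rw [← mul_assoc, hc]
    ring

theorem pointedRecordGF_eq_mul_invOfUnit :
    pointedRecordGF = t * cayleyTree * PowerSeries.invOfUnit (1 - t * cayleyTree) 1 := by
  have h : t * cayleyTree = pointedRecordGF * (1 - t * cayleyTree) := by
    linear_combination -pointedRecordGF_eq
  calc pointedRecordGF
      = pointedRecordGF * ((1 - t * cayleyTree) *
          PowerSeries.invOfUnit (1 - t * cayleyTree) 1) := by rw [one_sub_mul_invOfUnit, mul_one]
    _ = _ := by rw [← mul_assoc, ← h]

theorem recordPoly_fin_zero : recordPoly (Fin 0) = 0 := by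
  have : IsEmpty (ParentTree (Fin 0)) := ⟨fun T => T.root.elim0⟩
  simp [recordPoly]

end CayleyRecords

theorem mainTheorem4 :
    CayleyRecords.treeRecordGF =
      CayleyRecords.integral
        (CayleyRecords.divZ
          (CayleyRecords.t * CayleyRecords.cayleyTree *
            PowerSeries.invOfUnit (1 - CayleyRecords.t * CayleyRecords.cayleyTree) 1)) := by
  rw [← CayleyRecords.pointedRecordGF_eq_mul_invOfUnit]
  ext1 n
  rw [CayleyRecords.integral, PowerSeries.coeff_mk]
  cases n with
  | zero => simp [CayleyRecords.coeff_treeRecordGF_eq, CayleyRecords.recordPoly_fin_zero]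
  | succ n =>
    rw [if_neg n.succ_ne_zero, CayleyRecords.divZ, PowerSeries.coeff_mk, Nat.add_sub_cancel,
      CayleyRecords.pointedRecordGF, PowerSeries.coeff_mk, ← nsmul_eq_mul, ← Nat.cast_smul_eq_nsmul ℚ,
      smul_smul, one_div, inv_mul_cancel₀ (Nat.cast_ne_zero.2 n.succ_ne_zero), one_smul]
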